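/- Let $n\ge 1$ and let $\varphi:[0,\infty)\to[0,\infty)$ be an increasing, concave, continuous function with $\varphi(0)=0$ and $\lim_{t\to\infty}\varphi(t)=\infty$ (so that $\varphi$ is a bijection of $[0,\infty)$). Then there is a constant $c_{\varphi,n}<\infty$, depending only on $\varphi$ and $n$, such that the following holds for every non-atomic Radon (that is, locally finite Borel) measure $\mu$ on $\mathbb R^n$. There is an orthonormal system of coordinates of $\mathbb R^n$ such that (*) $\mu(\partial Q)=0$ for every cube $Q$ with sides parallel to the axes of the system. Moreover, fix any orthonormal system of coordinates with property (*), and for measurable $f:\mathbb R^n\to\mathbb R$ put $$\|f\|_{BMO(\mu)}=\sup_Q\frac1{\mu(Q)}\int_Q|f-f_Q|\,d\mu,\qquad f_Q=\frac1{\mu(Q)}\int_Q f\,d\mu,$$ $$\|f\|_{BMO_\varphi(\mu)}=\sup_Q\inf_{c\in\mathbb R}\inf\Big\{\lambda>0:\frac1{\mu(Q)}\int_Q\varphi\Big(\frac{|f-c|}{\lambda}\Big)\,d\mu\le1\Big\},$$ where the suprema are over all cubes $Q$ with sides parallel to the axes of the system and $\mu(Q)>0$, and $\|f\|_{BMO(\mu)}=\infty$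 if $f$ is not integrable on some such cube. Let $BMO(\mu)$ be the class of the locally $\mu$-integrable $f$ with $\|f\|_{BMO(\mu)}<\infty$, and $BMO_\varphi(\mu)$ the class of the measurable $f$ with $\|f\|_{BMO_\varphi(\mu)}<\infty$. Then $BMO(\mu)=BMO_\varphi(\mu)$, and for every measurable $f$ $$\varphi^{-1}(1)\,\|f\|_{BMO_\varphi(\mu)}\le\|f\|_{BMO(\mu)}\le c_{\varphi,n}\,\|f\|_{BMO_\varphi(\mu)}.$$ -/

import Mathlib

open MeasureTheory Filter Set
open scoped NNReal ENNReal

noncomputable section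

namespace MinimalBMO

/-- The closed cube with lower corner `a` and side length `s`, with sides parallel to the axes of
the orthonormal coordinate system `b` of `ℝⁿ` (`b.repr x i` is the `i`-th coordinate of `x`). -/
def cube {n : ℕ} (b : OrthonormalBasis (Fin n) ℝ (EuclideanSpace ℝ (Fin n)))
    (a : Fin n → ℝ) (s : ℝ) : Set (EuclideanSpace ℝ (Fin n)) :=
  {x | ∀ i, b.repr x i ∈ Icc (a i) (a i + s)}

/-- The boundary of every cube with sides parallel to the axes of `b` is `μ`-null. -/
def NullBoundaries {n : ℕ} (μ : Measure (EuclideanSpace ℝ (Fin n)))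
    (b : OrthonormalBasis (Fin n) ℝ (EuclideanSpace ℝ (Fin n))) : Prop :=
  ∀ (a : Fin n → ℝ) (s : ℝ), 0 < s → μ (frontier (cube b a s)) = 0

/-- The Luxemburg expression
`inf {l > 0 : (1 / μ(Q)) ∫_Q φ(|g| / l) dμ ≤ 1}` (`∞` if there is no such `l`). -/
def luxemburg {n : ℕ} (φ : ℝ≥0 → ℝ≥0) (μ : Measure (EuclideanSpace ℝ (Fin n)))
    (Q : Set (EuclideanSpace ℝ (Fin n))) (g : EuclideanSpace ℝ (Fin n) → ℝ) : ℝ≥0∞ :=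
  ⨅ (l : ℝ≥0) (_ : 0 < l) (_ : ⨍⁻ x in Q, (φ (‖g x‖₊ / l) : ℝ≥0∞) ∂μ ≤ 1), (l : ℝ≥0∞)

/-- `‖f‖_{BMO_φ(μ)} = sup_Q inf_c ‖f - c‖_{φ,Q,μ}`, with values in `[0,∞]`; the supremum is over
the cubes of positive measure. -/
def bmoPhiNorm {n : ℕ} (φ : ℝ≥0 → ℝ≥0) (μ : Measure (EuclideanSpace ℝ (Fin n)))
    (b : OrthonormalBasis (Fin n) ℝ (EuclideanSpace ℝ (Fin n)))
    (f : EuclideanSpace ℝ (Fin n) → ℝ) : ℝ≥0∞ :=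
  ⨆ (a : Fin n → ℝ) (s : ℝ) (_ : 0 < s) (_ : μ (cube b a s) ≠ 0),
    ⨅ c : ℝ, luxemburg φ μ (cube b a s) (fun x => f x - c)

/-- `‖f‖_{BMO(μ)} = sup_Q (1 / μ(Q)) ∫_Q |f - f_Q| dμ`, with values in `[0,∞]`; the supremum is
over the cubes of positive measure. If a measurable `f` is not integrable on such a cube (of finite
measure), then `f_Q` is `0` by convention, and the corresponding term is `∞`. -/
def bmoNorm {n : ℕ} (μ : Measure (EuclideanSpace ℝ (Fin n)))
    (b : OrthonormalBasis (Fin n) ℝ (EuclideanSpace ℝ (Fin n)))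
    (f : EuclideanSpace ℝ (Fin n) → ℝ) : ℝ≥0∞ :=
  ⨆ (a : Fin n → ℝ) (s : ℝ) (_ : 0 < s) (_ : μ (cube b a s) ≠ 0),
    ⨍⁻ x in cube b a s, ‖f x - ⨍ y in cube b a s, f y ∂μ‖ₑ ∂μ

/-- The class `BMO_φ(μ)`. No local integrability is required. -/
def BMOPhi {n : ℕ} (φ : ℝ≥0 → ℝ≥0) (μ : Measure (EuclideanSpace ℝ (Fin n)))
    (b : OrthonormalBasis (Fin n) ℝ (EuclideanSpace ℝ (Fin n))) :
    Set (EuclideanSpace ℝ (Fin n) → ℝ) :=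
  {f | AEMeasurable f μ ∧ bmoPhiNorm φ μ b f < ∞}

/-- The class `BMO(μ)`. -/
def BMO {n : ℕ} (μ : Measure (EuclideanSpace ℝ (Fin n)))
    (b : OrthonormalBasis (Fin n) ℝ (EuclideanSpace ℝ (Fin n))) :
    Set (EuclideanSpace ℝ (Fin n) → ℝ) :=
  {f | LocallyIntegrable f μ ∧ bmoNorm μ b f < ∞}

end MinimalBMO

end

/-!
The measure may be far from doubling, so the argument never compares a cube with its dilates; it
uses instead that the measure of a cube depends continuously on the cube.

*The coordinate system.* Reflect the standard basis in the line spanned by `w`. For `v ≠ 0` the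
condition that `v` is orthogonal to a fixed reflected basis vector is a nontrivial quadratic equation
in `w`, so it holds for almost no `w`. Since `μ` has no atoms, the diagonal is null for `μ × μ`, and
Fubini's theorem gives a `w` such that for `μ × μ`-almost all `(x, y)` the difference `x - y` is
orthogonal to no vector of the reflected basis
(`exists_orthonormalBasis_measure_hyperplane_eq_zero`). If `H` is a coordinate hyperplane, then
`H × H` consists of exceptional pairs, so `μ H = 0`.

*The lower bound* is Jensen's inequality for the concave function `φ`, applied with `c = f_Q`
(`mul_bmoPhiNorm_le`); it is carried out with a supporting line (`exists_affine_majorant`), so that no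
integrability has to be discussed.

*The upper bound.* Choose `t` with `φ t ≥ 4 * 36 ^ n`. By Chebyshev's inequality, for every
`L > ‖f‖_{BMO_φ}` each cube `Q` has a constant `c_Q` such that `|f - c_Q| > t * L` on at most the
fraction `1 / (4 * 36 ^ n)` of `Q` (`mul_measure_inter_lt_abs_le`). Put `l = t * L` and let `E` be this
exceptional subset of `Q`. Around almost every point of `E` there are small cubes mostly filled by
`E`, whereas `Q` itself is not half filled. Let the cubes grow inside `Q`, staying centred at the
point for as long as possible. As boundaries are null, the measures vary continuously, so at some
moment the cube is exactly half filled (`exists_subbox_half`). A Besicovitch type selection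
(`exists_bounded_overlap_cover`) covers almost all of `E` by such cubes `Q_j` with overlap at most
`36 ^ n`, whence `∑ μ(Q_j) ≤ 2 * 36 ^ n * μ(E) ≤ μ(Q) / 2`. On a half filled cube both
`|f - c_{Q_j}| ≤ l` and `|f - c_Q| ≤ l` hold at a common point, so
`|c_{Q_j} - c_Q| ≤ 2 * l`. Iteration gives
`μ {x ∈ Q | |f - c_Q| > 2 * k * l} ≤ 2 ^ (-k) * μ(Q)` (`measure_box_inter_lt_abs_sub_le`), and
summation over `k` bounds the mean oscillation by `8 * l = 8 * t * L`.

The covering and the iteration take place in `Fin n → ℝ` with the supremum norm, whose closed balls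
are the cubes; the coordinates of the chosen basis carry `μ` there.
-/

namespace MinimalBMO

open scoped Topology RealInnerProductSpace

/-! ### Orthonormal bases whose coordinate hyperplanes are null -/

section

variable {E : Type*} [NormedAddCommGroup E] [InnerProductSpace ℝ E]

/-- `‖w‖² ⟪R u, v⟫`, where `R` is the reflection in the line spanned by `w`. -/
def reflectionForm (u v w : E) : ℝ :=
  2 * ⟪w, u⟫ * ⟪w, v⟫ - ‖w‖ ^ 2 * ⟪u, v⟫

lemma reflectionForm_eq (u v w : E) :
    reflectionForm u v w = ‖w‖ ^ 2 * ⟪(ℝ ∙ w).reflection u, v⟫ := by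
  rw [Submodule.reflection_singleton_apply, reflectionForm, inner_sub_left, two_smul,
    inner_add_left, real_inner_smul_left]
  rcases eq_or_ne w 0 with rfl | hw
  · simp
  · have : ‖w‖ ≠ 0 := norm_ne_zero_iff.2 hw
    simp only [RCLike.ofReal_real_eq_id, id]
    field_simp
    ring

lemma exists_reflectionForm_ne_zero {u v : E} (hu : u ≠ 0) (hv : v ≠ 0) :
    ∃ w, reflectionForm u v w ≠ 0 := by
  have hu' : ‖u‖ ≠ 0 := norm_ne_zero_iff.2 hu
  have hv' : ‖v‖ ≠ 0 := norm_ne_zero_iff.2 hv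
  by_cases h : ⟪u, v⟫ = 0
  · refine ⟨u + v, ?_⟩
    have h' : ⟪v, u⟫ = 0 := by rwa [real_inner_comm]
    simp only [reflectionForm, inner_add_left, h, h', real_inner_self_eq_norm_sq]
    simp [hu', hv']
  · refine ⟨u, ?_⟩
    rw [reflectionForm, real_inner_self_eq_norm_sq,
      show 2 * ‖u‖ ^ 2 * ⟪u, v⟫ - ‖u‖ ^ 2 * ⟪u, v⟫ = ‖u‖ ^ 2 * ⟪u, v⟫ by ring]
    exact mul_ne_zero (pow_ne_zero _ hu') h

/-- Along every line in a direction where the form does not vanish it is a quadratic polynomial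
with nonzero leading coefficient. -/
lemma finite_reflectionForm_add_smul_eq_zero {u v w₁ : E} (h : reflectionForm u v w₁ ≠ 0) (w : E) :
    {t : ℝ | reflectionForm u v (w + t • w₁) = 0}.Finite := by
  let B : ℝ := 2 * (⟪w, u⟫ * ⟪w₁, v⟫ + ⟪w₁, u⟫ * ⟪w, v⟫) - 2 * ⟪w, w₁⟫ * ⟪u, v⟫
  let P : Polynomial ℝ := Polynomial.C (reflectionForm u v w₁) * Polynomial.X ^ 2 +
    Polynomial.C B * Polynomial.X + Polynomial.C (reflectionForm u v w)
  have hP : P ≠ 0 := by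
    intro h0
    have := congrArg (fun p => Polynomial.coeff p 2) h0
    simp [P] at this
    exact h this
  refine (P.roots.toFinset.finite_toSet).subset fun t ht => ?_
  rw [Finset.mem_coe, Multiset.mem_toFinset, Polynomial.mem_roots hP, Polynomial.IsRoot.def]
  rw [mem_ofPred_eq] at ht
  rw [← ht]
  simp only [P, B, Polynomial.eval_add, Polynomial.eval_mul, Polynomial.eval_C,
    Polynomial.eval_pow, Polynomial.eval_X, reflectionForm, inner_add_left, real_inner_smul_left,
    norm_add_sq_real, norm_smul, inner_smul_right, Real.norm_eq_abs, mul_pow, sq_abs]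
  ring

variable [FiniteDimensional ℝ E] [MeasurableSpace E] [BorelSpace E]

lemma ae_reflectionForm_ne_zero {u v : E} (hu : u ≠ 0) (hv : v ≠ 0) :
    ∀ᵐ w ∂(volume : Measure E), reflectionForm u v w ≠ 0 := by
  obtain ⟨w₁, h⟩ := exists_reflectionForm_ne_zero hu hv
  have hm : MeasurableSet {w : E | reflectionForm u v w ≠ 0} := by
    unfold reflectionForm
    measurability
  refine (ae_ae_add_linearMap_mem_iff (LinearMap.toSpanSingleton ℝ E w₁) (volume : Measure ℝ)
    (volume : Measure E) hm).1 (Eventually.of_forall fun w => ?_)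
  have := (finite_reflectionForm_add_smul_eq_zero h w).measure_zero volume
  rw [ae_iff]
  simpa [LinearMap.toSpanSingleton_apply] using this

/-- A measure without atoms has an orthonormal basis none of whose coordinate hyperplanes is
charged: by Fubini, for almost every `w`, the product `μ × μ` does not charge the pairs `(x, y)`
with `x - y` orthogonal to a vector of the reflected basis. -/
theorem exists_orthonormalBasis_measure_hyperplane_eq_zero {ι : Type*} [Fintype ι]
    (b₀ : OrthonormalBasis ι ℝ E) (μ : Measure E) [SigmaFinite μ] [NullSingletonClass μ] :
    ∃ b : OrthonormalBasis ι ℝ E, ∀ (i : ι) (c : ℝ), μ {x | b.repr x i = c} = 0 := by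
  have hdiag : ∀ᵐ p ∂(μ.prod μ), p.1 ≠ p.2 := by
    refine (Measure.ae_prod_iff_ae_ae (p := fun p : E × E => p.1 ≠ p.2)
      (measurableSet_eq_fun measurable_fst measurable_snd).compl).2 ?_
    refine Eventually.of_forall fun x => ?_
    rw [ae_iff]
    simp
  have h : ∀ i, ∀ᵐ w ∂(volume : Measure E), ∀ᵐ p ∂(μ.prod μ),
      reflectionForm (b₀ i) (p.1 - p.2) w ≠ 0 := by
    intro i
    have hm : MeasurableSet {x : (E × E) × E | reflectionForm (b₀ i) (x.1.1 - x.1.2) x.2 ≠ 0} := by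
      unfold reflectionForm
      refine IsOpen.measurableSet (isOpen_ne_fun ?_ continuous_const)
      fun_prop
    rw [← Measure.ae_ae_comm
      (p := fun (p : E × E) (w : E) => reflectionForm (b₀ i) (p.1 - p.2) w ≠ 0) hm]
    filter_upwards [hdiag] with p hp
    exact ae_reflectionForm_ne_zero (b₀.orthonormal.ne_zero i) (sub_ne_zero.2 hp)
  obtain ⟨w, hw⟩ := (ae_all_iff.2 h).exists
  refine ⟨b₀.map (ℝ ∙ w).reflection, fun i c => ?_⟩
  set H := {x : E | (b₀.map (ℝ ∙ w).reflection).repr x i = c} with hH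
  have hprod : (μ.prod μ) (H ×ˢ H) = 0 := by
    refine measure_mono_null ?_ (ae_iff.1 (hw i))
    rintro ⟨x, y⟩ ⟨hx, hy⟩
    simp only [hH, mem_ofPred_eq, OrthonormalBasis.repr_apply_apply, OrthonormalBasis.map_apply]
      at hx hy
    simp [reflectionForm_eq, inner_sub_right, hx, hy]
  rw [Measure.prod_prod] at hprod
  exact mul_self_eq_zero.1 hprod

end

/-! ### Cubes inside a cube -/

section

/-- The closed cube of `Fin n → ℝ` with lower corner `a` and side length `s`. -/
def box {n : ℕ} (a : Fin n → ℝ) (s : ℝ) : Set (Fin n → ℝ) :=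
  {x | ∀ i, x i ∈ Icc (a i) (a i + s)}

/-- The lower corner of the cube of side length `r` inside `box a s` that is centred at `x` as far
as this is possible: in each coordinate the interval of length `r` centred at `x i` is moved by the
least amount that brings it into `[a i, a i + s]`. -/
noncomputable def corner {n : ℕ} (a : Fin n → ℝ) (s : ℝ) (x : Fin n → ℝ) (r : ℝ) : Fin n → ℝ :=
  fun i => max (a i) (min (x i - r / 2) (a i + s - r))

/-- The cube of side length `r` inside `box a s` that is centred at `x` as far as possible. -/
noncomputable def subbox {n : ℕ} (a : Fin n → ℝ) (s : ℝ) (x : Fin n → ℝ) (r : ℝ) : Set (Fin n → ℝ) :=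
  box (corner a s x r) r

lemma subbox_subset {n : ℕ} {a : Fin n → ℝ} {s r : ℝ} (hrs : r ≤ s) (x : Fin n → ℝ) :
    subbox a s x r ⊆ box a s := by
  intro y hy i
  have h := hy i
  simp only [corner, mem_Icc] at h ⊢
  have h1 : max (a i) (min (x i - r / 2) (a i + s - r)) ≤ a i + s - r :=
    max_le (by linarith) (min_le_right _ _)
  exact ⟨(le_max_left _ _).trans h.1, by linarith⟩

lemma subbox_self {n : ℕ} {a : Fin n → ℝ} {s : ℝ} (x : Fin n → ℝ) :
    subbox a s x s = box a s := by
  have : corner a s x s = a := by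
    funext i
    simp only [corner]
    exact max_eq_left ((min_le_right _ _).trans (by linarith))
  rw [subbox, this]

lemma mem_subbox_of_abs_le {n : ℕ} {a : Fin n → ℝ} {s r : ℝ} {x y : Fin n → ℝ}
    (hx : x ∈ box a s) (hy : y ∈ box a s)
    (h : ∀ i, |x i - y i| ≤ r / 2) : y ∈ subbox a s x r := by
  intro i
  have hx := hx i
  have hy := hy i
  have h := abs_le.1 (h i)
  simp only [corner, mem_Icc] at *
  constructor
  · exact max_le hy.1 ((min_le_left _ _).trans (by linarith))
  · rcases le_total (x i - r / 2) (a i + s - r) with h1 | h1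
    · rw [min_eq_left h1]
      linarith [le_max_right (a i) (x i - r / 2)]
    · rw [min_eq_right h1]
      linarith [le_max_right (a i) (a i + s - r)]

/-- The mechanism that bounds the overlap. Suppose that `z` lies in the cubes belonging to `x` and
`y`, that the cube of `y` is the smaller one, and that in every coordinate `x` and `y` lie on the
same side of `z` and their intervals are moved in the same way. Then `y` lies in the cube of
`x`. -/
lemma mem_subbox_of_same_type {n : ℕ} {a : Fin n → ℝ} {s r t : ℝ} {x y z : Fin n → ℝ}
    (hy : y ∈ box a s) (ht : 0 < t) (htr : t ≤ r) (hrs : r ≤ s)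
    (hzx : z ∈ subbox a s x r) (hzy : z ∈ subbox a s y t)
    (hleft : ∀ i, x i < a i + r / 2 ↔ y i < a i + t / 2)
    (hright : ∀ i, a i + s - r / 2 < x i ↔ a i + s - t / 2 < y i)
    (hside : ∀ i, z i ≤ x i ↔ z i ≤ y i) : y ∈ subbox a s x r := by
  intro i
  have hy := hy i
  have hzx := hzx i
  have hzy := hzy i
  have h1 := hleft i
  have h2 := hright i
  have h3 := hside i
  simp only [corner, mem_Icc] at *
  grind

lemma box_eq_pi {n : ℕ} (a : Fin n → ℝ) (s : ℝ) :
    box a s = Set.pi univ fun i => Icc (a i) (a i + s) := by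
  ext x; simp only [box, mem_ofPred_eq, mem_univ_pi]

lemma isCompact_box {n : ℕ} (a : Fin n → ℝ) (s : ℝ) : IsCompact (box a s) := by
  rw [box_eq_pi]
  exact isCompact_univ_pi fun _ => isCompact_Icc

lemma measurableSet_box {n : ℕ} (a : Fin n → ℝ) (s : ℝ) : MeasurableSet (box a s) :=
  (isCompact_box a s).isClosed.measurableSet

end

/-! ### A covering lemma with bounded overlap -/

section

/-- Greedy selection along a well-founded relation: a point of `E` is selected unless it is
related to a point that was selected before it. -/
lemma exists_greedy_selection {α : Type*} {lt : α → α → Prop} (wf : WellFounded lt) (E : Set α)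
    (R : α → α → Prop) :
    ∃ S : Set α, ∀ x, x ∈ S ↔ x ∈ E ∧ ∀ y ∈ S, lt y x → ¬ R y x := by
  let F : (x : α) → ((y : α) → lt y x → Prop) → Prop :=
    fun x ih => x ∈ E ∧ ∀ y, ∀ h : lt y x, ih y h → ¬ R y x
  refine ⟨{x | wf.fix F x}, fun x => ?_⟩
  have : wf.fix F x = F x (fun y _ => wf.fix F y) := wf.fix_eq F x
  rw [mem_ofPred_eq, this]
  simp only [F, mem_ofPred_eq]
  grind

/-- A Besicovitch type covering lemma inside a fixed cube. If every point `x` of `E ⊆ box a s` is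
given a radius `r x ∈ (0, s]`, then countably many of the cubes `subbox a s x (r x)` cover `E`,
and no point lies in more than `36 ^ n` of them. -/
theorem exists_bounded_overlap_cover {n : ℕ} {a : Fin n → ℝ} {s : ℝ} (hs : 0 < s)
    {E : Set (Fin n → ℝ)} (hE : E ⊆ box a s) {r : (Fin n → ℝ) → ℝ}
    (hr : ∀ x ∈ E, 0 < r x) (hrs : ∀ x ∈ E, r x ≤ s) :
    ∃ S ⊆ E, S.Countable ∧ (∀ x ∈ E, ∃ y ∈ S, x ∈ subbox a s y (r y)) ∧
      ∀ (z : Fin n → ℝ) (T : Finset (Fin n → ℝ)), (∀ x ∈ T, x ∈ S ∧ z ∈ subbox a s x (r x)) →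
        T.card ≤ 36 ^ n := by
  -- `k x` is the dyadic level of `r x`.
  have hk : ∀ x, ∃ k : ℕ, x ∈ E → s * (1 / 2 : ℝ) ^ (k + 1) < r x ∧ r x ≤ s * (1 / 2 : ℝ) ^ k := by
    intro x
    by_cases hx : x ∈ E
    · obtain ⟨k, h1, h2⟩ := exists_nat_pow_near_of_lt_one (x := r x / s) (y := (1 / 2 : ℝ))
        (div_pos (hr x hx) hs) ((div_le_one hs).2 (hrs x hx)) (by norm_num) (by norm_num)
      refine ⟨k, fun _ => ⟨?_, ?_⟩⟩
      · rw [lt_div_iff₀ hs] at h1; linarith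
      · rw [div_le_iff₀ hs] at h2; linarith
    · exact ⟨0, fun h => absurd h hx⟩
  choose k hk using hk
  let lt : (Fin n → ℝ) → (Fin n → ℝ) → Prop :=
    InvImage (Prod.Lex (· < ·) WellOrderingRel) (fun x => (k x, x))
  have wf : WellFounded lt :=
    InvImage.wf _ (WellFounded.prod_lex wellFounded_lt WellOrderingRel.isWellOrder.wf)
  have tri : ∀ x y, x ≠ y → lt x y ∨ lt y x := by
    intro x y hxy
    simp only [lt, InvImage, Prod.lex_def]
    rcases lt_trichotomy (k x) (k y) with h | h | h
    · exact Or.inl (Or.inl h)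
    · rcases trichotomous_of WellOrderingRel x y with h' | h' | h'
      · exact Or.inl (Or.inr ⟨h, h'⟩)
      · exact absurd h' hxy
      · exact Or.inr (Or.inr ⟨h.symm, h'⟩)
    · exact Or.inr (Or.inl h)
  have ltk : ∀ x y, lt x y → k x ≤ k y := by
    intro x y h
    simp only [lt, InvImage, Prod.lex_def] at h
    rcases h with h | h
    · exact h.le
    · exact h.1.le
  obtain ⟨S, hS⟩ := exists_greedy_selection wf E (fun y x => x ∈ subbox a s y (r y))
  have hSE : S ⊆ E := fun x hx => ((hS x).1 hx).1
  have self_mem : ∀ x ∈ E, x ∈ subbox a s x (r x) := fun x hx =>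
    mem_subbox_of_abs_le (hE hx) (hE hx)
      (fun i => by have := hr x hx; simp; linarith)
  have hcover : ∀ x ∈ E, ∃ y ∈ S, x ∈ subbox a s y (r y) := by
    intro x hx
    by_cases hxS : x ∈ S
    · exact ⟨x, hxS, self_mem x hx⟩
    · have := mt (hS x).2 hxS
      push Not at this
      obtain ⟨y, hy, -, h⟩ := this hx
      exact ⟨y, hy, h⟩
  have hoverlap : ∀ (z : Fin n → ℝ) (T : Finset (Fin n → ℝ)),
      (∀ x ∈ T, x ∈ S ∧ z ∈ subbox a s x (r x)) → T.card ≤ 36 ^ n := by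
    classical
    intro z T hT
    -- Colour `x` by the way its intervals are moved, and by the position of `x - z` in a grid
    -- whose mesh is a quarter of the scale of `r x`.
    let col : (Fin n → ℝ) → Fin n → Bool × Bool × ℤ := fun x i =>
      (decide (x i < a i + r x / 2), decide (a i + s - r x / 2 < x i),
        ⌊(x i - z i) * 4 / (s * (1 / 2 : ℝ) ^ k x)⌋)
    let P : Finset (Fin n → Bool × Bool × ℤ) :=
      Fintype.piFinset fun _ => Finset.univ ×ˢ Finset.univ ×ˢ Finset.Icc (-4) 4
    have hP : P.card = 36 ^ n := by
      simp [P, Fintype.card_piFinset]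
    rw [← hP]
    have hpos : ∀ m : ℕ, 0 < s * (1 / 2 : ℝ) ^ m := fun m => by positivity
    refine Finset.card_le_card_of_injOn col ?_ ?_
    · intro x hx
      obtain ⟨hxS, hxz⟩ := hT x hx
      have hxE := hSE hxS
      simp only [P, Finset.mem_coe, Fintype.mem_piFinset, Finset.mem_product, Finset.mem_univ,
        true_and, Finset.mem_Icc]
      intro i
      have h1 := hxz i
      have h2 := self_mem x hxE i
      have h3 := (hk x hxE).2
      have h4 := hpos (k x)
      simp only [mem_Icc] at h1 h2
      constructor
      · rw [Int.le_floor, le_div_iff₀ h4]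
        push_cast
        linarith
      · rw [← Int.lt_add_one_iff, Int.floor_lt, div_lt_iff₀ h4]
        push_cast
        linarith
    · -- Of two selected points with the same colour, the later one lies in the cube of the
      -- earlier one.
      have key : ∀ x ∈ T, ∀ y ∈ T, col x = col y → ¬ lt x y := by
        intro x hx y hy hxy hlt
        obtain ⟨hxS, hxz⟩ := hT x hx
        obtain ⟨hyS, hyz⟩ := hT y hy
        have hxE := hSE hxS
        have hyE := hSE hyS
        refine ((hS y).1 hyS).2 x hxS hlt ?_
        have hcol : ∀ i, (x i < a i + r x / 2 ↔ y i < a i + r y / 2) ∧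
            (a i + s - r x / 2 < x i ↔ a i + s - r y / 2 < y i) ∧
            ⌊(x i - z i) * 4 / (s * (1 / 2 : ℝ) ^ k x)⌋ =
              ⌊(y i - z i) * 4 / (s * (1 / 2 : ℝ) ^ k y)⌋ := by
          intro i
          have := congrFun hxy i
          simpa only [col, Prod.mk.injEq, decide_eq_decide] using this
        rcases (ltk x y hlt).eq_or_lt with hkk | hkk
        · refine mem_subbox_of_abs_le (hE hxE) (hE hyE) fun i => ?_
          have h1 := (hcol i).2.2
          rw [← hkk] at h1
          have h2 := Int.abs_sub_lt_one_of_floor_eq_floor h1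
          have h4 := hpos (k x)
          rw [← sub_div, abs_div, abs_of_pos h4, div_lt_one h4] at h2
          have h3 := (hk x hxE).1
          rw [pow_succ] at h3
          have h5 : |(x i - z i) * 4 - (y i - z i) * 4| = |x i - y i| * 4 := by
            rw [← sub_mul, abs_mul]; norm_num
          rw [h5] at h2
          linarith
        · have hle : r y ≤ r x := by
            have h1 : (1 / 2 : ℝ) ^ k y ≤ (1 / 2 : ℝ) ^ (k x + 1) :=
              pow_le_pow_of_le_one (by norm_num) (by norm_num) hkk
            have h2 := mul_le_mul_of_nonneg_left h1 hs.le
            linarith [(hk x hxE).1, (hk y hyE).2]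
          have side : ∀ (m : ℕ) (t : ℝ), 0 ≤ ⌊t * 4 / (s * (1 / 2 : ℝ) ^ m)⌋ ↔ 0 ≤ t := by
            intro m t
            rw [Int.floor_nonneg, le_div_iff₀ (hpos m)]
            constructor <;> intro h <;> linarith
          refine mem_subbox_of_same_type (hE hyE) (hr y hyE) hle (hrs x hxE) hxz hyz
            (fun i => (hcol i).1) (fun i => (hcol i).2.1) fun i => ?_
          rw [← sub_nonneg, ← side (k x), (hcol i).2.2, side (k y), sub_nonneg]
      intro x hx y hy hxy
      by_contra hne
      rcases tri x y hne with h | h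
      · exact key x hx y hy hxy h
      · exact key y hy x hx hxy.symm h
  refine ⟨S, hSE, ?_, hcover, hoverlap⟩
  -- Every cube has interior points, so the cubes are enumerated by a countable dense set.
  obtain ⟨D, hDc, hDd⟩ := TopologicalSpace.exists_countable_dense (Fin n → ℝ)
  have hsub : S ⊆ ⋃ q ∈ D, {x | x ∈ S ∧ q ∈ subbox a s x (r x)} := by
    intro x hx
    have hrx := hr x (hSE hx)
    have hop : IsOpen (Set.pi univ fun i : Fin n =>
        Ioo (corner a s x (r x) i) (corner a s x (r x) i + r x)) :=
      isOpen_set_pi finite_univ fun _ _ => isOpen_Ioo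
    have hne : (Set.pi univ fun i : Fin n =>
        Ioo (corner a s x (r x) i) (corner a s x (r x) i + r x)).Nonempty :=
      univ_pi_nonempty_iff.2 fun i => nonempty_Ioo.2 (by linarith)
    obtain ⟨q, hq, hqD⟩ := hDd.inter_open_nonempty _ hop hne
    refine mem_biUnion hqD ⟨hx, fun i => Ioo_subset_Icc_self (hq i (mem_univ i))⟩
  refine (hDc.biUnion fun q _ => Set.Finite.countable ?_).mono hsub
  by_contra hinf
  obtain ⟨T, hT, hTc⟩ := Set.Infinite.exists_subset_card_eq hinf (36 ^ n + 1)
  have := hoverlap q T fun x hx => hT hx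
  omega

lemma tsum_measure_le_of_bounded_overlap {α ι : Type*} [MeasurableSpace α] (ρ : Measure α)
    {S : Set ι} (hS : S.Countable) {A : ι → Set α} (hA : ∀ i, MeasurableSet (A i)) (N : ℕ)
    (hN : ∀ (z : α) (T : Finset ι), (∀ i ∈ T, i ∈ S ∧ z ∈ A i) → T.card ≤ N) :
    ∑' i : S, ρ (A i) ≤ N * ρ univ := by
  classical
  have : Countable S := hS.to_subtype
  calc ∑' i : S, ρ (A i) = ∑' i : S, ∫⁻ z, (A (i : ι)).indicator 1 z ∂ρ := by
        simp_rw [lintegral_indicator_one (hA _)]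
    _ = ∫⁻ z, ∑' i : S, (A (i : ι)).indicator 1 z ∂ρ :=
        (lintegral_tsum fun i : S => (measurable_one.indicator (hA i)).aemeasurable).symm
    _ ≤ ∫⁻ _, (N : ℝ≥0∞) ∂ρ := by
        refine lintegral_mono fun z => ?_
        rw [ENNReal.tsum_eq_iSup_sum]
        refine iSup_le fun T => ?_
        have h1 := hN z ((T.filter fun i : S => z ∈ A i).map ⟨Subtype.val, Subtype.val_injective⟩) (by
          intro i hi
          simp only [Finset.mem_map, Finset.mem_filter] at hi
          obtain ⟨j, hj, rfl⟩ := hi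
          exact ⟨j.2, hj.2⟩)
        rw [Finset.card_map] at h1
        simp only [indicator_apply, Pi.one_apply, Finset.sum_boole]
        exact_mod_cast h1
    _ = N * ρ univ := by rw [lintegral_const]

end

/-! ### Half filled cubes -/

section

/-- The measure of the cubes around `x` inside `box a s` depends continuously on their size, since no
hyperplane parallel to the axes is charged. -/
lemma continuous_measure_subbox {n : ℕ} (ρ : Measure (Fin n → ℝ)) [IsFiniteMeasure ρ]
    (hρ : ∀ (i : Fin n) (c : ℝ), ρ {x | x i = c} = 0) (a : Fin n → ℝ) (s : ℝ) (x : Fin n → ℝ) :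
    Continuous fun r => ρ (subbox a s x r) := by
  have hcor : ∀ i, Continuous fun r => corner a s x r i := by
    intro i; unfold corner; fun_prop
  refine continuous_iff_continuousAt.2 fun r₀ => ?_
  refine tendsto_measure_of_ae_tendsto_indicator_of_isFiniteMeasure (𝓝 r₀)
    (measurableSet_box _ _) (fun _ => measurableSet_box _ _) ?_
  have h1 : ∀ᵐ y ∂ρ, ∀ i, y i ≠ corner a s x r₀ i ∧ y i ≠ corner a s x r₀ i + r₀ := by
    refine ae_all_iff.2 fun i => ?_
    have e1 : ∀ᵐ y ∂ρ, y i ≠ corner a s x r₀ i := by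
      rw [ae_iff]; simpa using hρ i (corner a s x r₀ i)
    have e2 : ∀ᵐ y ∂ρ, y i ≠ corner a s x r₀ i + r₀ := by
      rw [ae_iff]; simpa using hρ i (corner a s x r₀ i + r₀)
    filter_upwards [e1, e2] with y a b using ⟨a, b⟩
  filter_upwards [h1] with y hy
  have h2 : ∀ᶠ r in 𝓝 r₀, ∀ i, (y i ∈ Icc (corner a s x r i) (corner a s x r i + r) ↔
      y i ∈ Icc (corner a s x r₀ i) (corner a s x r₀ i + r₀)) := by
    refine eventually_all.2 fun i => ?_
    have c1 : Tendsto (fun r => corner a s x r i) (𝓝 r₀) (𝓝 (corner a s x r₀ i)) :=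
      (hcor i).tendsto r₀
    have c2 : Tendsto (fun r => corner a s x r i + r) (𝓝 r₀) (𝓝 (corner a s x r₀ i + r₀)) :=
      ((hcor i).add continuous_id).tendsto r₀
    have d1 : ∀ᶠ r in 𝓝 r₀, (corner a s x r i ≤ y i ↔ corner a s x r₀ i ≤ y i) := by
      rcases lt_or_gt_of_ne (hy i).1 with h | h
      · filter_upwards [c1.eventually (lt_mem_nhds h)] with r hr
        exact iff_of_false hr.not_ge h.not_ge
      · filter_upwards [c1.eventually (gt_mem_nhds h)] with r hr
        exact iff_of_true hr.le h.le
    have d2 : ∀ᶠ r in 𝓝 r₀, (y i ≤ corner a s x r i + r ↔ y i ≤ corner a s x r₀ i + r₀) := by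
      rcases lt_or_gt_of_ne (hy i).2 with h | h
      · filter_upwards [c2.eventually (lt_mem_nhds h)] with r hr
        exact iff_of_true hr.le h.le
      · filter_upwards [c2.eventually (gt_mem_nhds h)] with r hr
        exact iff_of_false hr.not_ge h.not_ge
    filter_upwards [d1, d2] with r e1 e2
    rw [mem_Icc, mem_Icc, e1, e2]
  filter_upwards [h2] with r hr
  exact forall_congr' hr

variable {n : ℕ} {ν : Measure (Fin n → ℝ)} [IsLocallyFiniteMeasure ν]

/-- If `E` fills at least half of a small cube around `x` but at most half of `box a s`, then it
fills exactly half of some intermediate cube. This is where the null boundaries enter. -/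
lemma exists_subbox_half (hν : ∀ (i : Fin n) (c : ℝ), ν {x | x i = c} = 0)
    {a : Fin n → ℝ} {s : ℝ} {E : Set (Fin n → ℝ)} (hE : E ⊆ box a s)
    (hEs : 2 * ν E ≤ ν (box a s)) {x : Fin n → ℝ} {r₁ : ℝ} (hr₁s : r₁ ≤ s)
    (hr₁ : ν (subbox a s x r₁) ≤ 2 * ν (subbox a s x r₁ ∩ E)) :
    ∃ r, r₁ ≤ r ∧ r ≤ s ∧ ν (subbox a s x r) = 2 * ν (subbox a s x r ∩ E) := by
  have hfin : ν (box a s) < ∞ := (isCompact_box a s).measure_lt_top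
  have : IsFiniteMeasure (ν.restrict (box a s)) := ⟨by simpa using hfin⟩
  have : IsFiniteMeasure (ν.restrict E) := ⟨by simpa using (measure_mono hE).trans_lt hfin⟩
  have null : ∀ F : Set (Fin n → ℝ), ∀ (i : Fin n) (c : ℝ), ν.restrict F {x | x i = c} = 0 :=
    fun F i c => Measure.restrict_le_self.absolutelyContinuous (hν i c)
  have e1 : ∀ r ≤ s, ν.restrict (box a s) (subbox a s x r) = ν (subbox a s x r) := by
    intro r hr
    rw [subbox, Measure.restrict_apply (measurableSet_box _ _), ← subbox, inter_eq_left.2 (subbox_subset hr x)]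
  have e2 : ∀ r, ν.restrict E (subbox a s x r) = ν (subbox a s x r ∩ E) := fun r =>
    Measure.restrict_apply (measurableSet_box _ _)
  obtain ⟨r, hr, h⟩ := isPreconnected_Icc.intermediate_value₂ (left_mem_Icc.2 hr₁s)
    (right_mem_Icc.2 hr₁s)
    (continuous_measure_subbox (ν.restrict (box a s)) (null _) a s x).continuousOn
    ((ENNReal.continuous_const_mul (by simp : (2 : ℝ≥0∞) ≠ ∞)).comp
      (continuous_measure_subbox (ν.restrict E) (null _) a s x)).continuousOn
    (by simpa only [Function.comp_apply, e1 r₁ hr₁s, e2] using hr₁)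
    (by
      rw [Function.comp_apply, e1 s le_rfl, e2, subbox_self, inter_eq_right.2 hE]
      exact hEs)
  refine ⟨r, hr.1, hr.2, ?_⟩
  simpa only [Function.comp_apply, e1 r hr.2, e2] using h

/-- Almost every point of `E` is the centre of a small cube at least half of which belongs to `E`.
By the density theorem for balls of the supremum norm; `E` need not be measurable. -/
lemma ae_exists_subbox_density (hν : ∀ (i : Fin n) (c : ℝ), ν {x | x i = c} = 0)
    {a : Fin n → ℝ} {s : ℝ} (hs : 0 < s) {E : Set (Fin n → ℝ)} (hE : E ⊆ box a s) :
    ∀ᵐ x ∂ν, x ∈ E → ∃ r, 0 < r ∧ r ≤ s ∧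
      ν (subbox a s x r) ≤ 2 * ν (subbox a s x r ∩ E) := by
  have h0 : ∀ᵐ x ∂ν, ∀ i, x i ≠ a i ∧ x i ≠ a i + s := by
    refine ae_all_iff.2 fun i => ?_
    have e1 : ∀ᵐ y ∂ν, y i ≠ a i := by
      rw [ae_iff]; simpa using hν i (a i)
    have e2 : ∀ᵐ y ∂ν, y i ≠ a i + s := by
      rw [ae_iff]; simpa using hν i (a i + s)
    filter_upwards [e1, e2] with y a b using ⟨a, b⟩
  filter_upwards [h0, ae_imp_of_ae_restrict (Besicovitch.ae_tendsto_measure_inter_div ν E)]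
    with x hx hdens hxE
  have hd := (hdens hxE).eventually (lt_mem_nhds (show (1 / 2 : ℝ≥0∞) < 1 by
    simp))
  have hin : ∀ᶠ ε in 𝓝[>] (0 : ℝ), ∀ i, ε < x i - a i ∧ ε < a i + s - x i := by
    refine eventually_all.2 fun i => ?_
    have h1 := hE hxE i
    have h2 := hx i
    have h3 : 0 < x i - a i := sub_pos.2 (lt_of_le_of_ne h1.1 h2.1.symm)
    have h4 : 0 < a i + s - x i := sub_pos.2 (lt_of_le_of_ne h1.2 h2.2)
    filter_upwards [nhdsWithin_le_nhds (gt_mem_nhds h3), nhdsWithin_le_nhds (gt_mem_nhds h4)]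
      with ε e1 e2 using ⟨e1, e2⟩
  have hs2 : ∀ᶠ ε in 𝓝[>] (0 : ℝ), ε < s / 2 := nhdsWithin_le_nhds (gt_mem_nhds (by positivity))
  obtain ⟨ε, ⟨h1, h2, h3⟩, h4⟩ := ((hd.and (hin.and hs2)).and self_mem_nhdsWithin).exists
  have hε : 0 < ε := h4
  have hball : Metric.closedBall x ε = subbox a s x (2 * ε) := by
    have hc : corner a s x (2 * ε) = fun i => x i - ε := by
      funext i
      have := h2 i
      simp only [corner]
      rw [min_eq_left (by linarith), max_eq_right (by linarith)]
      ring
    ext y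
    rw [subbox, hc, Metric.mem_closedBall, dist_pi_le_iff hε.le]
    refine forall_congr' fun i => ?_
    rw [Real.dist_eq, abs_le, mem_Icc]
    constructor <;> rintro ⟨p, q⟩ <;> constructor <;> linarith
  refine ⟨2 * ε, by positivity, by linarith, ?_⟩
  rw [← hball, inter_comm]
  have h5 := (ENNReal.mul_lt_of_lt_div h1).le
  calc ν (Metric.closedBall x ε) = 2 * (1 / 2 * ν (Metric.closedBall x ε)) := by
        rw [← mul_assoc, one_div, ENNReal.mul_inv_cancel (by simp) (by simp), one_mul]
    _ ≤ _ := by gcongr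

end

/-! ### Exponential decay of the oscillation -/

section

variable {n : ℕ} {ν : Measure (Fin n → ℝ)} [IsLocallyFiniteMeasure ν]

/-- One step of the iteration that gives exponential decay: the part of `box a s` where `g` is far
from `c a s` is covered by cubes half filled by `{l < |g - c a s|}`, and on each of them the
constant changes by at most `2 * l`. -/
lemma measure_box_inter_lt_abs_sub_step (hν : ∀ (i : Fin n) (c : ℝ), ν {x | x i = c} = 0)
    {g : (Fin n → ℝ) → ℝ} {c : (Fin n → ℝ) → ℝ → ℝ} {l : ℝ} (hl : 0 < l)
    (H : ∀ (a : Fin n → ℝ) (s : ℝ), 0 < s → ν (box a s) ≠ 0 →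
      4 * 36 ^ n * ν (box a s ∩ {x | l < |g x - c a s|}) ≤ ν (box a s))
    {t : ℝ} (ht : 0 ≤ t) {K : ℝ≥0∞}
    (ih : ∀ (a : Fin n → ℝ) (s : ℝ), 0 < s → ν (box a s) ≠ 0 →
      K * ν (box a s ∩ {x | t < |g x - c a s|}) ≤ ν (box a s))
    (a : Fin n → ℝ) (s : ℝ) (hs : 0 < s) (h0 : ν (box a s) ≠ 0) :
    2 * K * ν (box a s ∩ {x | t + 2 * l < |g x - c a s|}) ≤ ν (box a s) := by
  have four : ∀ (x : ℝ≥0∞), 4 * x ≤ 4 * 36 ^ n * x := by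
    intro x
    gcongr
    exact le_mul_of_one_le_right' (one_le_pow₀ (by norm_num))
  set E := box a s ∩ {x | l < |g x - c a s|} with hEdef
  have hE : E ⊆ box a s := inter_subset_left
  have hEs : 2 * ν E ≤ ν (box a s) :=
    le_trans (by gcongr; norm_num) ((four _).trans (H a s hs h0))
  -- `E'` consists of the points of `E` that have a half filled cube.
  let E' := {x ∈ E | ∃ r, 0 < r ∧ r ≤ s ∧ ν (subbox a s x r) = 2 * ν (subbox a s x r ∩ E)}
  have hE' : ν (E \ E') = 0 := by
    have := ae_exists_subbox_density hν hs hE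
    refine measure_mono_null ?_ (ae_iff.1 this)
    rintro x ⟨hx, hx'⟩ h
    obtain ⟨r, h1, h2, h3⟩ := h hx
    obtain ⟨r', h4, h5, h6⟩ := exists_subbox_half hν hE hEs h2 h3
    exact hx' ⟨hx, r', h1.trans_le h4, h5, h6⟩
  have hex : ∀ x, ∃ r, x ∈ E' →
      0 < r ∧ r ≤ s ∧ ν (subbox a s x r) = 2 * ν (subbox a s x r ∩ E) := by
    intro x
    by_cases hx : x ∈ E'
    · obtain ⟨r, h⟩ := hx.2
      exact ⟨r, fun _ => h⟩
    · exact ⟨0, fun h => absurd h hx⟩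
  choose r hr using hex
  obtain ⟨S, hSE, hSc, hcov, hover⟩ := exists_bounded_overlap_cover hs
    (show E' ⊆ box a s from fun x hx => hE hx.1) (fun x hx => (hr x hx).1)
    (fun x hx => (hr x hx).2.1)
  have : Countable S := hSc.to_subtype
  set D := box a s ∩ {x | t + 2 * l < |g x - c a s|} with hD
  have hDE : D ⊆ E := by
    rintro x ⟨h1, h2⟩
    refine ⟨h1, ?_⟩
    rw [mem_ofPred_eq] at h2 ⊢
    linarith
  have hDcov : D ⊆ (E \ E') ∪ ⋃ x : S, (D ∩ subbox a s x (r x)) := by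
    intro x hx
    by_cases hx' : x ∈ E'
    · obtain ⟨y, hy, hxy⟩ := hcov x hx'
      exact Or.inr (mem_iUnion.2 ⟨⟨y, hy⟩, hx, hxy⟩)
    · exact Or.inl ⟨hDE hx, hx'⟩
  have hDsum : ν D ≤ ∑' x : S, ν (D ∩ subbox a s x (r x)) := by
    calc ν D ≤ ν (E \ E') + ν (⋃ x : S, (D ∩ subbox a s x (r x))) :=
          (measure_mono hDcov).trans (measure_union_le _ _)
      _ ≤ _ := by
          rw [hE', zero_add]
          exact measure_iUnion_le _
  have hterm : ∀ x : S, K * ν (D ∩ subbox a s x (r x)) ≤ 2 * ν (subbox a s x (r x) ∩ E) := by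
    rintro ⟨x, hxS⟩
    obtain ⟨hrpos, hrs, hhalf⟩ := hr x (hSE hxS)
    rw [← hhalf]
    rcases eq_or_ne (ν (subbox a s x (r x))) 0 with hz | hz
    · rw [measure_mono_null inter_subset_right hz, mul_zero]
      exact zero_le
    set c' := c (corner a s x (r x)) (r x) with hc'
    -- The two constants are both within `l` of a common value of `g`.
    have hclose : |c' - c a s| ≤ 2 * l := by
      by_contra hfar
      push Not at hfar
      have hsub : subbox a s x (r x) ⊆
          (subbox a s x (r x) ∩ E) ∪ (subbox a s x (r x) ∩ {y | l < |g y - c'|}) := by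
        intro y hy
        by_cases hyE : y ∈ E
        · exact Or.inl ⟨hy, hyE⟩
        · refine Or.inr ⟨hy, ?_⟩
          have h1 : |g y - c a s| ≤ l := by
            by_contra h
            exact hyE ⟨subbox_subset hrs x hy, not_le.1 h⟩
          have h2 : |c' - c a s| ≤ |g y - c a s| + |g y - c'| := by
            have := abs_sub (g y - c a s) (g y - c')
            rwa [show g y - c a s - (g y - c') = c' - c a s by ring] at this
          rw [mem_ofPred_eq]
          linarith
      have hm := (measure_mono (μ := ν) hsub).trans (measure_union_le _ _)
      have hH := (four _).trans (H (corner a s x (r x)) (r x) hrpos hz)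
      have hfin : ν (subbox a s x (r x)) ≠ ∞ := (isCompact_box _ _).measure_lt_top.ne
      have hfin1 := ne_top_of_le_ne_top hfin
        (measure_mono (μ := ν) (inter_subset_left (s := subbox a s x (r x)) (t := E)))
      have hfin2 := ne_top_of_le_ne_top hfin
        (measure_mono (μ := ν) (inter_subset_left (s := subbox a s x (r x)) (t := {y | l < |g y - c'|})))
      change 4 * ν (subbox a s x (r x) ∩ {y | l < |g y - c'|}) ≤ ν (subbox a s x (r x)) at hH
      revert hm hH hhalf hz
      lift ν (subbox a s x (r x)) to ℝ≥0 using hfin with A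
      lift ν (subbox a s x (r x) ∩ E) to ℝ≥0 using hfin1 with B
      lift ν (subbox a s x (r x) ∩ {y | l < |g y - c'|}) to ℝ≥0 using hfin2 with C
      intro hhalf hz hm hH
      norm_cast at hz hhalf hm hH
      have hA : 0 < A := pos_iff_ne_zero.2 hz
      have e1 : (A : ℝ) = 2 * B := by exact_mod_cast hhalf
      have e2 : (A : ℝ) ≤ B + C := by exact_mod_cast hm
      have e3 : 4 * (C : ℝ) ≤ A := by exact_mod_cast hH
      have e4 : (0 : ℝ) < A := hA
      linarith
    refine le_trans ?_ (ih (corner a s x (r x)) (r x) hrpos hz)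
    refine mul_le_mul' le_rfl (measure_mono ?_)
    rintro y ⟨⟨-, hy⟩, hy'⟩
    refine ⟨hy', ?_⟩
    rw [mem_ofPred_eq] at hy ⊢
    have h2 : |g y - c a s| ≤ |g y - c'| + |c' - c a s| := abs_sub_le _ _ _
    linarith
  have hsum : ∑' x : S, ν (subbox a s x (r x) ∩ E) ≤ 36 ^ n * ν E := by
    have := tsum_measure_le_of_bounded_overlap (ν.restrict E) hSc
      (A := fun x => subbox a s x (r x)) (fun x => measurableSet_box _ _) (36 ^ n) hover
    simpa [Measure.restrict_apply, subbox, measurableSet_box] using this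
  calc 2 * K * ν D ≤ 2 * K * ∑' x : S, ν (D ∩ subbox a s x (r x)) := by gcongr
    _ = 2 * ∑' x : S, K * ν (D ∩ subbox a s x (r x)) := by rw [mul_assoc, ENNReal.tsum_mul_left]
    _ ≤ 2 * ∑' x : S, 2 * ν (subbox a s x (r x) ∩ E) := by
        gcongr 2 * ?_
        exact ENNReal.tsum_le_tsum hterm
    _ = 4 * ∑' x : S, ν (subbox a s x (r x) ∩ E) := by
        rw [ENNReal.tsum_mul_left, ← mul_assoc]; norm_num
    _ ≤ 4 * (36 ^ n * ν E) := by gcongr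
    _ ≤ ν (box a s) := by
        rw [← mul_assoc]
        exact H a s hs h0

/-- Exponential decay of the oscillation, for a measure that does not charge hyperplanes parallel to
the axes. -/
theorem measure_box_inter_lt_abs_sub_le (hν : ∀ (i : Fin n) (c : ℝ), ν {x | x i = c} = 0)
    {g : (Fin n → ℝ) → ℝ} {c : (Fin n → ℝ) → ℝ → ℝ} {l : ℝ} (hl : 0 < l)
    (H : ∀ (a : Fin n → ℝ) (s : ℝ), 0 < s → ν (box a s) ≠ 0 →
      4 * 36 ^ n * ν (box a s ∩ {x | l < |g x - c a s|}) ≤ ν (box a s)) (k : ℕ) :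
    ∀ (a : Fin n → ℝ) (s : ℝ), 0 < s → ν (box a s) ≠ 0 →
      2 ^ k * ν (box a s ∩ {x | k * (2 * l) < |g x - c a s|}) ≤ ν (box a s) := by
  induction k with
  | zero =>
    intro a s _ _
    rw [pow_zero, one_mul]
    exact measure_mono inter_subset_left
  | succ k ih =>
    intro a s hs h0
    have := measure_box_inter_lt_abs_sub_step hν hl H (by positivity) ih a s hs h0
    rw [pow_succ', Nat.cast_succ, add_mul, one_mul]
    exact this

end

/-! ### Cubes in an orthonormal coordinate system -/

section

variable {n : ℕ}

/-- The homeomorphism from Euclidean space to `Fin n → ℝ` given by the coordinates in the basis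
`b`. -/
noncomputable def coords (b : OrthonormalBasis (Fin n) ℝ (EuclideanSpace ℝ (Fin n))) :
    EuclideanSpace ℝ (Fin n) ≃ₜ (Fin n → ℝ) :=
  b.repr.toHomeomorph.trans (PiLp.homeomorph 2 _)

lemma coords_apply (b : OrthonormalBasis (Fin n) ℝ (EuclideanSpace ℝ (Fin n)))
    (x : EuclideanSpace ℝ (Fin n)) (i : Fin n) : coords b x i = b.repr x i := rfl

lemma cube_eq_preimage (b : OrthonormalBasis (Fin n) ℝ (EuclideanSpace ℝ (Fin n)))
    (a : Fin n → ℝ) (s : ℝ) : cube b a s = coords b ⁻¹' box a s := rfl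

lemma isCompact_cube (b : OrthonormalBasis (Fin n) ℝ (EuclideanSpace ℝ (Fin n)))
    (a : Fin n → ℝ) (s : ℝ) : IsCompact (cube b a s) := by
  rw [cube_eq_preimage]
  exact (coords b).isCompact_preimage.2 (isCompact_box a s)

lemma frontier_box (a : Fin n → ℝ) (s : ℝ) :
    frontier (box a s) = {x ∈ box a s | ∃ i, x i = a i ∨ x i = a i + s} := by
  rw [(isCompact_box a s).isClosed.frontier_eq, box_eq_pi, interior_pi_set finite_univ]
  simp only [interior_Icc]
  ext x
  simp only [Set.mem_sdiff, Set.mem_pi, mem_univ, true_imp_iff, mem_Icc, mem_Ioo, mem_ofPred_eq, not_forall]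
  refine and_congr_right fun h => exists_congr fun i => ?_
  have := h i
  grind

lemma frontier_cube (b : OrthonormalBasis (Fin n) ℝ (EuclideanSpace ℝ (Fin n)))
    (a : Fin n → ℝ) (s : ℝ) :
    frontier (cube b a s) = coords b ⁻¹' frontier (box a s) := by
  rw [cube_eq_preimage, (coords b).preimage_frontier]

/-- The boundaries of all cubes are null if and only if all coordinate hyperplanes are. -/
lemma nullBoundaries_iff (μ : Measure (EuclideanSpace ℝ (Fin n)))
    (b : OrthonormalBasis (Fin n) ℝ (EuclideanSpace ℝ (Fin n))) :
    NullBoundaries μ b ↔ ∀ (i : Fin n) (c : ℝ), μ {x | b.repr x i = c} = 0 := by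
  constructor
  · intro h i c
    let a : ℕ → Fin n → ℝ := fun N => Function.update (fun _ => -(N + 1 : ℝ)) i c
    have hsub : {x | b.repr x i = c} ⊆ ⋃ N : ℕ, frontier (cube b (a N) (2 * (N + 1))) := by
      intro x hx
      obtain ⟨N, hN⟩ := exists_nat_ge ‖coords b x‖
      refine mem_iUnion.2 ⟨N, ?_⟩
      rw [frontier_cube, mem_preimage, frontier_box]
      have hxi : coords b x i = a N i := by simpa [a, coords_apply] using hx
      refine ⟨fun j => ?_, i, Or.inl hxi⟩
      rcases eq_or_ne j i with rfl | hj
      · rw [hxi]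
        exact ⟨le_rfl, by have : (0 : ℝ) ≤ N := N.cast_nonneg; linarith⟩
      · have h1 := abs_le.1 ((norm_le_pi_norm (coords b x) j).trans hN)
        simp only [a, Function.update_of_ne hj, mem_Icc]
        constructor <;> linarith [h1.1, h1.2]
    exact measure_mono_null hsub (measure_iUnion_null fun N => h _ _ (by positivity))
  · intro h a s _
    have hsub : frontier (cube b a s) ⊆
        ⋃ i, ({x | b.repr x i = a i} ∪ {x | b.repr x i = a i + s}) := by
      rw [frontier_cube, frontier_box]
      rintro x ⟨-, i, hi⟩
      exact mem_iUnion.2 ⟨i, hi⟩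
    exact measure_mono_null hsub
      (measure_iUnion_null fun i => measure_union_null (h _ _) (h _ _))

/-- Exponential decay of the oscillation, for the cubes of an orthonormal coordinate system. -/
theorem measure_cube_inter_lt_abs_sub_le {μ : Measure (EuclideanSpace ℝ (Fin n))}
    [IsLocallyFiniteMeasure μ] {b : OrthonormalBasis (Fin n) ℝ (EuclideanSpace ℝ (Fin n))}
    (hb : NullBoundaries μ b) {f : EuclideanSpace ℝ (Fin n) → ℝ} {c : (Fin n → ℝ) → ℝ → ℝ}
    {l : ℝ} (hl : 0 < l)
    (H : ∀ (a : Fin n → ℝ) (s : ℝ), 0 < s → μ (cube b a s) ≠ 0 →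
      4 * 36 ^ n * μ (cube b a s ∩ {x | l < |f x - c a s|}) ≤ μ (cube b a s))
    (k : ℕ) (a : Fin n → ℝ) (s : ℝ) (hs : 0 < s) (h0 : μ (cube b a s) ≠ 0) :
    2 ^ k * μ (cube b a s ∩ {x | k * (2 * l) < |f x - c a s|}) ≤ μ (cube b a s) := by
  let e := (coords b).toMeasurableEquiv
  let ν := μ.map e
  have : IsFiniteMeasureOnCompacts ν := MeasureTheory.Measure.IsFiniteMeasureOnCompacts.map μ (coords b)
  have hbox : ∀ a s, ν (box a s) = μ (cube b a s) := fun a s => e.map_apply _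
  have hint : ∀ a s t, ν (box a s ∩ {x | t < |f (e.symm x) - c a s|}) =
      μ (cube b a s ∩ {x | t < |f x - c a s|}) := by
    intro a s t
    refine (e.map_apply _).trans ?_
    congr 1
    ext x
    simp only [mem_preimage, mem_inter_iff, mem_ofPred_eq, e.symm_apply_apply]
    rfl
  have hν : ∀ (i : Fin n) (c : ℝ), ν {x | x i = c} = 0 := fun i c =>
    (e.map_apply _).trans ((nullBoundaries_iff μ b).1 hb i c)
  have := measure_box_inter_lt_abs_sub_le hν (g := fun x => f (e.symm x)) (c := c) hl
    (fun a s hs h => by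
      rw [hint, hbox]
      exact H a s hs (by rwa [← hbox])) k a s hs (by rwa [hbox])
  rwa [hint, hbox] at this

end

/-! ### Concave functions and integral inequalities -/

section

/-- A supporting line from above for a nondecreasing concave function; its slope and its intercept
are nonnegative. -/
lemma exists_affine_majorant {φ : ℝ≥0 → ℝ≥0} (hmono : Monotone φ)
    (hconc : ConcaveOn ℝ≥0 Set.univ φ) {u : ℝ≥0} (hu : 0 < u) :
    ∃ α m : ℝ≥0, α + m * u = φ u ∧ ∀ t, φ t ≤ α + m * t := by
  let ψ : ℝ → ℝ := fun x => φ x.toNNReal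
  have hψ : ConcaveOn ℝ (Ici 0) ψ := by
    refine ⟨convex_Ici 0, fun x hx y hy a b ha hb hab => ?_⟩
    rw [mem_Ici] at hx hy
    lift x to ℝ≥0 using hx
    lift y to ℝ≥0 using hy
    lift a to ℝ≥0 using ha
    lift b to ℝ≥0 using hb
    have h := hconc.2 (mem_univ x) (mem_univ y) (zero_le (a := a)) (zero_le (a := b))
      (by exact_mod_cast hab)
    have e : (a : ℝ) • (x : ℝ) + (b : ℝ) • (y : ℝ) = ((a • x + b • y : ℝ≥0) : ℝ) := by simp
    simp only [ψ, e, Real.toNNReal_coe]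
    exact_mod_cast h
  have hψc : ∀ x : ℝ≥0, ψ x = φ x := fun x => by simp [ψ]
  have hu' : (0 : ℝ) < u := hu
  -- The slope of the line separates the slopes of the chords to the right of `u` from those of the
  -- chords to the left of `u`.
  obtain ⟨m, hm1, hm2⟩ := exists_between_of_forall_le
    (s := (fun t : ℝ => (ψ t - ψ u) / (t - u)) '' Ioi (u : ℝ))
    (t := (fun s : ℝ => (ψ u - ψ s) / (u - s)) '' Ico 0 (u : ℝ))
    ⟨_, mem_image_of_mem _ (mem_Ioi.2 (lt_add_one _))⟩
    ⟨_, mem_image_of_mem _ (left_mem_Ico.2 hu')⟩ (by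
      rintro _ ⟨t, ht, rfl⟩ _ ⟨s, hs, rfl⟩
      exact hψ.slope_anti_adjacent hs.1 (hu'.le.trans (mem_Ioi.1 ht).le) hs.2 ht)
  have hm0 : 0 ≤ m := by
    refine le_trans ?_ (hm1 (mem_image_of_mem _ (mem_Ioi.2 (lt_add_one _))))
    have : φ u ≤ φ (u + 1) := hmono (by simp)
    have h2 : ψ (u + 1) = φ (u + 1) := by simpa using hψc (u + 1)
    rw [h2, hψc]
    have h3 : (φ u : ℝ) ≤ φ (u + 1) := this
    exact div_nonneg (by linarith) (by linarith)
  have hle : ∀ t : ℝ≥0, (φ t : ℝ) ≤ φ u - m * u + m * t := by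
    intro t
    rw [← hψc, ← hψc]
    rcases lt_trichotomy (t : ℝ) u with h | h | h
    · have := hm2 (mem_image_of_mem _ (mem_Ico.2 ⟨t.2, h⟩))
      rw [le_div_iff₀ (by exact sub_pos.2 h)] at this
      change m * (u - t) ≤ ψ u - ψ t at this
      linarith
    · rw [h]; linarith
    · have := hm1 (mem_image_of_mem _ (mem_Ioi.2 h))
      change (ψ t - ψ u) / (t - u) ≤ m at this
      rw [div_le_iff₀ (sub_pos.2 h)] at this
      linarith
  have hα : 0 ≤ φ u - m * u := by
    have := hle 0
    have h0 : (0 : ℝ) ≤ φ 0 := (φ 0).2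
    simp only [NNReal.coe_zero, mul_zero, add_zero] at this
    linarith
  obtain ⟨α, hα⟩ : ∃ α : ℝ≥0, (α : ℝ) = φ u - m * u := ⟨⟨_, hα⟩, rfl⟩
  lift m to ℝ≥0 using hm0
  refine ⟨α, m, NNReal.coe_injective ?_, fun t => NNReal.coe_le_coe.1 ?_⟩
  · push_cast
    rw [hα]
    ring
  · push_cast
    rw [hα]
    exact hle t

variable {X : Type*} [MeasurableSpace X]

/-- Jensen's inequality in the form `E φ(|g| / l) ≤ φ(E |g| / l) ≤ φ(u) = 1`. -/
lemma lintegral_comp_le_one {φ : ℝ≥0 → ℝ≥0} (hmono : Monotone φ)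
    (hconc : ConcaveOn ℝ≥0 Set.univ φ) {u : ℝ≥0} (hu : 0 < u) (hφu : φ u = 1)
    (κ : Measure X) [IsProbabilityMeasure κ] {g : X → ℝ} {l : ℝ≥0} (hl : 0 < l)
    (h : ∫⁻ x, ‖g x‖ₑ ∂κ ≤ u * l) :
    ∫⁻ x, (φ (‖g x‖₊ / l) : ℝ≥0∞) ∂κ ≤ 1 := by
  obtain ⟨α, m, hα, hle⟩ := exists_affine_majorant hmono hconc hu
  calc ∫⁻ x, (φ (‖g x‖₊ / l) : ℝ≥0∞) ∂κ ≤ ∫⁻ x, (α + ↑(m / l) * ‖g x‖ₑ : ℝ≥0∞) ∂κ := by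
        refine lintegral_mono fun x => ?_
        rw [enorm_eq_nnnorm]
        have := hle (‖g x‖₊ / l)
        rw [show m * (‖g x‖₊ / l) = m / l * ‖g x‖₊ by ring] at this
        rw [← ENNReal.coe_mul, ← ENNReal.coe_add]
        exact ENNReal.coe_le_coe.2 this
    _ = α + ↑(m / l) * ∫⁻ x, ‖g x‖ₑ ∂κ := by
        rw [lintegral_add_left measurable_const, lintegral_const, measure_univ, mul_one,
          lintegral_const_mul' _ _ ENNReal.coe_ne_top]
    _ ≤ α + ↑(m / l) * (u * l) := by gcongr
    _ = 1 := by
        have : α + m / l * (u * l) = 1 := by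
          rw [← hφu, ← hα]
          field_simp
        exact_mod_cast this

/-- If `f` is not integrable, the integral on the left is `0` by convention; the right side is then
infinite. -/
lemma lintegral_enorm_sub_integral_le (κ : Measure X) [IsProbabilityMeasure κ] {f : X → ℝ}
    (hf : AEMeasurable f κ) (c : ℝ) :
    ∫⁻ x, ‖f x - ∫ y, f y ∂κ‖ₑ ∂κ ≤ 2 * ∫⁻ x, ‖f x - c‖ₑ ∂κ := by
  rcases eq_or_ne (∫⁻ x, ‖f x - c‖ₑ ∂κ) ∞ with h | h
  · simp [h]
  have hint : Integrable (fun x => f x - c) κ :=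
    ⟨(hf.sub_const c).aestronglyMeasurable, h.lt_top⟩
  have hfint : Integrable f κ :=
    (hint.add (integrable_const c)).congr (Eventually.of_forall fun x => sub_add_cancel (f x) c)
  have hc : ‖c - ∫ y, f y ∂κ‖ₑ ≤ ∫⁻ x, ‖f x - c‖ₑ ∂κ := by
    have : ∫ x, (f x - c) ∂κ = (∫ y, f y ∂κ) - c := by
      rw [integral_sub hfint (integrable_const c)]; simp
    rw [← enorm_neg, neg_sub, ← this]
    exact enorm_integral_le_lintegral_enorm _
  calc ∫⁻ x, ‖f x - ∫ y, f y ∂κ‖ₑ ∂κ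
      ≤ ∫⁻ x, (‖f x - c‖ₑ + ∫⁻ x, ‖f x - c‖ₑ ∂κ) ∂κ := by
        refine lintegral_mono fun x => ?_
        rw [show f x - ∫ y, f y ∂κ = (f x - c) + (c - ∫ y, f y ∂κ) by ring]
        exact (enorm_add_le _ _).trans (by gcongr)
    _ = 2 * ∫⁻ x, ‖f x - c‖ₑ ∂κ := by
        rw [lintegral_add_right _ measurable_const, lintegral_const, measure_univ, mul_one, two_mul]

/-- A dyadic layer cake bound: if the level sets of `g` at the multiples of `d` decay geometrically,
then the integral of `|g|` is at most `2 * d` times the total mass. -/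
lemma lintegral_enorm_le_of_geometric_decay (κ : Measure X) {g : X → ℝ} (hg : AEMeasurable g κ)
    {d : ℝ≥0} (hd : 0 < d)
    (h : ∀ k : ℕ, 2 ^ k * κ {x | k * (d : ℝ) < |g x|} ≤ κ univ) :
    ∫⁻ x, ‖g x‖ₑ ∂κ ≤ 2 * d * κ univ := by
  have hnull : ∀ k : ℕ, NullMeasurableSet {x | k * (d : ℝ) < |g x|} κ := fun k =>
    nullMeasurableSet_lt aemeasurable_const hg.abs
  have hd' : (0 : ℝ) < d := hd
  calc ∫⁻ x, ‖g x‖ₑ ∂κ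
      ≤ ∫⁻ x, ∑' k : ℕ, {x | k * (d : ℝ) < |g x|}.indicator (fun _ => (d : ℝ≥0∞)) x ∂κ := by
        refine lintegral_mono fun x => ?_
        -- Exactly the indices `k < |g x| / d` contribute, and there are at least `|g x| / d`.
        calc ‖g x‖ₑ ≤ ∑ k ∈ Finset.range ⌈|g x| / d⌉₊, (d : ℝ≥0∞) := by
              rw [Finset.sum_const, Finset.card_range, nsmul_eq_mul, enorm_eq_nnnorm]
              have h1 := Nat.le_ceil (|g x| / d)
              rw [div_le_iff₀ hd'] at h1
              have h2 : ‖g x‖₊ ≤ ⌈|g x| / d⌉₊ * d := by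
                rw [← NNReal.coe_le_coe]
                simpa using h1
              exact_mod_cast h2
          _ = ∑ k ∈ Finset.range ⌈|g x| / d⌉₊,
                {x | k * (d : ℝ) < |g x|}.indicator (fun _ => (d : ℝ≥0∞)) x := by
              refine Finset.sum_congr rfl fun k hk => ?_
              rw [Finset.mem_range, Nat.lt_ceil, lt_div_iff₀ hd'] at hk
              rw [indicator_of_mem (show x ∈ {x | k * (d : ℝ) < |g x|} from hk)]
          _ ≤ _ := ENNReal.sum_le_tsum _
    _ = ∑' k : ℕ, d * κ {x | k * (d : ℝ) < |g x|} := by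
        rw [lintegral_tsum fun k => aemeasurable_const.indicator₀ (hnull k)]
        refine tsum_congr fun k => ?_
        rw [lintegral_indicator₀ (hnull k), setLIntegral_const]
    _ ≤ ∑' k : ℕ, d * ((2 : ℝ≥0∞)⁻¹ ^ k * κ univ) := by
        refine ENNReal.tsum_le_tsum fun k => ?_
        gcongr
        rw [← ENNReal.inv_pow]
        calc κ {x | k * (d : ℝ) < |g x|}
            = ((2 : ℝ≥0∞) ^ k)⁻¹ * (2 ^ k * κ {x | k * (d : ℝ) < |g x|}) := by
              rw [← mul_assoc, ENNReal.inv_mul_cancel (by simp) (by simp), one_mul]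
          _ ≤ _ := by gcongr; exact h k
    _ = 2 * d * κ univ := by
        rw [ENNReal.tsum_mul_left, ENNReal.tsum_mul_right, ENNReal.tsum_geometric,
          ENNReal.one_sub_inv_two, inv_inv]
        ring

end

/-! ### Comparison of the two norms -/

section

variable {n : ℕ} {φ : ℝ≥0 → ℝ≥0} {μ : Measure (EuclideanSpace ℝ (Fin n))}

lemma mul_luxemburg_le (hmono : Monotone φ) (hconc : ConcaveOn ℝ≥0 Set.univ φ) {u : ℝ≥0}
    (hu : 0 < u) (hφu : φ u = 1) {Q : Set (EuclideanSpace ℝ (Fin n))} (h0 : μ Q ≠ 0)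
    (hfin : μ Q ≠ ∞) (g : EuclideanSpace ℝ (Fin n) → ℝ) :
    u * luxemburg φ μ Q g ≤ ⨍⁻ x in Q, ‖g x‖ₑ ∂μ := by
  have : IsFiniteMeasure (μ.restrict Q) := ⟨by simpa using hfin.lt_top⟩
  have : NeZero (μ.restrict Q) := ⟨by simpa using h0⟩
  -- The competitor is `l = (D + ε) / u`, where `D` is the mean of `|g|`; the `ε` makes it positive.
  refine ENNReal.le_of_forall_pos_le_add fun ε hε hD => ?_
  set D := ⨍⁻ x in Q, ‖g x‖ₑ ∂μ with hDdef
  lift D to ℝ≥0 using hD.ne with D'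
  have hl : 0 < (D' + ε) / u := by positivity
  have hul : u * ((D' + ε) / u) = D' + ε := by field_simp
  have hle : luxemburg φ μ Q g ≤ ((D' + ε) / u : ℝ≥0) := by
    refine iInf₂_le_of_le _ hl (iInf_le_of_le ?_ le_rfl)
    refine lintegral_comp_le_one hmono hconc hu hφu _ hl ?_
    change ⨍⁻ x in Q, ‖g x‖ₑ ∂μ ≤ _
    rw [← hDdef, ← ENNReal.coe_mul, hul]
    exact_mod_cast le_self_add
  calc u * luxemburg φ μ Q g ≤ u * ((D' + ε) / u : ℝ≥0) := by gcongr
    _ = D' + ε := by rw [← ENNReal.coe_mul, hul, ENNReal.coe_add]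

theorem mul_bmoPhiNorm_le (hmono : Monotone φ) (hconc : ConcaveOn ℝ≥0 Set.univ φ) {u : ℝ≥0}
    (hu : 0 < u) (hφu : φ u = 1) [IsLocallyFiniteMeasure μ]
    (b : OrthonormalBasis (Fin n) ℝ (EuclideanSpace ℝ (Fin n)))
    (f : EuclideanSpace ℝ (Fin n) → ℝ) :
    u * bmoPhiNorm φ μ b f ≤ bmoNorm μ b f := by
  simp only [bmoPhiNorm, ENNReal.mul_iSup]
  refine iSup_mono fun a => iSup_mono fun s => iSup_mono fun hs => iSup_mono fun h0 => ?_
  refine le_trans ?_ (mul_luxemburg_le hmono hconc hu hφu h0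
    (isCompact_cube b a s).measure_lt_top.ne _)
  gcongr
  exact iInf_le _ (⨍ y in cube b a s, f y ∂μ)

/-- Chebyshev's inequality for the Luxemburg expression. -/
lemma mul_measure_inter_lt_abs_le (hmono : Monotone φ) (hcont : Continuous φ)
    {Q : Set (EuclideanSpace ℝ (Fin n))} (hQ : MeasurableSet Q) (hfin : μ Q ≠ ∞)
    {g : EuclideanSpace ℝ (Fin n) → ℝ} (hg : AEMeasurable g μ) {l : ℝ≥0}
    (h : luxemburg φ μ Q g < l) (t : ℝ≥0) :
    φ t * μ (Q ∩ {x | ((t * l : ℝ≥0) : ℝ) < |g x|}) ≤ μ Q := by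
  simp only [luxemburg, iInf_lt_iff] at h
  obtain ⟨l', hl', hav, hlt⟩ := h
  have hll : l' < l := by exact_mod_cast hlt
  have hmeas : AEMeasurable (fun x => (φ (‖g x‖₊ / l') : ℝ≥0∞)) (μ.restrict Q) :=
    (hcont.measurable.comp_aemeasurable (hg.nnnorm.div_const l')).coe_nnreal_ennreal.restrict
  calc φ t * μ (Q ∩ {x | ((t * l : ℝ≥0) : ℝ) < |g x|})
      ≤ φ t * μ.restrict Q {x | (φ t : ℝ≥0∞) ≤ φ (‖g x‖₊ / l')} := by
        rw [Measure.restrict_apply' hQ, inter_comm]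
        gcongr with x
        intro hx
        refine ENNReal.coe_le_coe.2 (hmono ?_)
        rw [le_div_iff₀ hl', ← NNReal.coe_le_coe, coe_nnnorm, Real.norm_eq_abs]
        refine le_trans ?_ hx.le
        exact_mod_cast mul_le_mul_right hll.le t
    _ ≤ ∫⁻ x in Q, (φ (‖g x‖₊ / l') : ℝ≥0∞) ∂μ := mul_meas_ge_le_lintegral₀ hmeas _
    _ = μ Q * ⨍⁻ x in Q, (φ (‖g x‖₊ / l') : ℝ≥0∞) ∂μ := (measure_mul_setLAverage _ hfin).symm
    _ ≤ μ Q * 1 := by gcongr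
    _ = μ Q := mul_one _

theorem bmoNorm_le_mul_of_bmoPhiNorm_lt (hmono : Monotone φ) (hcont : Continuous φ)
    [IsLocallyFiniteMeasure μ] {b : OrthonormalBasis (Fin n) ℝ (EuclideanSpace ℝ (Fin n))}
    (hb : NullBoundaries μ b) {f : EuclideanSpace ℝ (Fin n) → ℝ} (hf : AEMeasurable f μ)
    {t : ℝ≥0} (ht0 : 0 < t) (ht : 4 * 36 ^ n ≤ φ t) {l : ℝ≥0} (hl : bmoPhiNorm φ μ b f < l) :
    bmoNorm μ b f ≤ 8 * t * l := by
  have hfin : ∀ a s, μ (cube b a s) ≠ ∞ := fun a s => (isCompact_cube b a s).measure_lt_top.ne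
  have hQ : ∀ a s, MeasurableSet (cube b a s) := fun a s =>
    (isCompact_cube b a s).isClosed.measurableSet
  have hl0 : 0 < l := by exact_mod_cast (zero_le (a := bmoPhiNorm φ μ b f)).trans_lt hl
  have hc : ∀ (a : Fin n → ℝ) (s : ℝ), ∃ c : ℝ, 0 < s → μ (cube b a s) ≠ 0 →
      luxemburg φ μ (cube b a s) (fun x => f x - c) < l := by
    intro a s
    by_cases h : 0 < s ∧ μ (cube b a s) ≠ 0
    · have h1 : ⨅ c : ℝ, luxemburg φ μ (cube b a s) (fun x => f x - c) < l := by
        refine lt_of_le_of_lt ?_ hl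
        exact le_iSup₂_of_le a s (le_iSup₂_of_le h.1 h.2 le_rfl)
      obtain ⟨c, hc⟩ := iInf_lt_iff.1 h1
      exact ⟨c, fun _ _ => hc⟩
    · exact ⟨0, fun h1 h2 => absurd ⟨h1, h2⟩ h⟩
  choose c hc using hc
  have hφt : (4 * 36 ^ n : ℝ≥0∞) ≤ φ t := by exact_mod_cast ht
  have hdecay := measure_cube_inter_lt_abs_sub_le hb (f := f) (c := c) (l := (t * l : ℝ≥0))
    (NNReal.coe_pos.2 (mul_pos ht0 hl0)) (fun a s hs h0 =>
      (mul_le_mul_left hφt _).trans (mul_measure_inter_lt_abs_le hmono hcont (hQ a s) (hfin a s)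
        (hf.sub_const _) (hc a s hs h0) t))
  refine iSup₂_le fun a s => iSup₂_le fun hs h0 => ?_
  have : IsFiniteMeasure (μ.restrict (cube b a s)) := ⟨by simpa using (hfin a s).lt_top⟩
  have : NeZero (μ.restrict (cube b a s)) := ⟨by simpa using h0⟩
  have hosc := lintegral_enorm_sub_integral_le
    (((μ.restrict (cube b a s)) univ)⁻¹ • μ.restrict (cube b a s))
    (f := f) (hf.restrict.smul_measure _) (c a s)
  have hint : ∫⁻ x in cube b a s, ‖f x - c a s‖ₑ ∂μ ≤ 4 * t * l * μ (cube b a s) := by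
    have := lintegral_enorm_le_of_geometric_decay (μ.restrict (cube b a s))
      (hf.sub_const (c a s)).restrict (d := 2 * (t * l)) (by positivity) (fun k => by
        rw [Measure.restrict_apply' (hQ a s), inter_comm, Measure.restrict_apply_univ]
        have := hdecay k a s hs h0
        push_cast at this ⊢
        exact this)
    rw [Measure.restrict_apply_univ] at this
    refine this.trans_eq ?_
    push_cast
    ring
  have hav : ⨍⁻ x in cube b a s, ‖f x - c a s‖ₑ ∂μ ≤ 4 * t * l := by
    rw [setLAverage_eq]
    exact ENNReal.div_le_of_le_mul hint
  calc ⨍⁻ x in cube b a s, ‖f x - ⨍ y in cube b a s, f y ∂μ‖ₑ ∂μ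
      ≤ 2 * ⨍⁻ x in cube b a s, ‖f x - c a s‖ₑ ∂μ := hosc
    _ ≤ 2 * (4 * t * l) := by gcongr
    _ = 8 * t * l := by ring

theorem bmoNorm_le_mul_bmoPhiNorm (hmono : Monotone φ) (hcont : Continuous φ)
    [IsLocallyFiniteMeasure μ] {b : OrthonormalBasis (Fin n) ℝ (EuclideanSpace ℝ (Fin n))}
    (hb : NullBoundaries μ b) {f : EuclideanSpace ℝ (Fin n) → ℝ} (hf : AEMeasurable f μ)
    {t : ℝ≥0} (ht0 : 0 < t) (ht : 4 * 36 ^ n ≤ φ t) :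
    bmoNorm μ b f ≤ ((8 * t : ℝ≥0) : ℝ≥0∞) * bmoPhiNorm φ μ b f := by
  have h8 : ((8 * t : ℝ≥0) : ℝ≥0∞) ≠ 0 := by positivity
  rw [← ENNReal.div_le_iff' h8 ENNReal.coe_ne_top]
  refine le_of_forall_gt_imp_ge_of_dense fun l hl => ?_
  rcases eq_or_ne l ∞ with rfl | hl'
  · exact le_top
  lift l to ℝ≥0 using hl'
  rw [ENNReal.div_le_iff' h8 ENNReal.coe_ne_top]
  exact (bmoNorm_le_mul_of_bmoPhiNorm_lt hmono hcont hb hf ht0 ht hl).trans_eq (by push_cast; rfl)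

lemma laverage_le_bmoNorm {b : OrthonormalBasis (Fin n) ℝ (EuclideanSpace ℝ (Fin n))}
    {f : EuclideanSpace ℝ (Fin n) → ℝ} {a : Fin n → ℝ} {s : ℝ} (hs : 0 < s)
    (h0 : μ (cube b a s) ≠ 0) :
    ⨍⁻ x in cube b a s, ‖f x - ⨍ y in cube b a s, f y ∂μ‖ₑ ∂μ ≤ bmoNorm μ b f :=
  le_iSup₂_of_le a s (le_iSup₂_of_le hs h0 le_rfl)

lemma locallyIntegrable_of_bmoNorm_lt_top [IsLocallyFiniteMeasure μ]
    {b : OrthonormalBasis (Fin n) ℝ (EuclideanSpace ℝ (Fin n))}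
    {f : EuclideanSpace ℝ (Fin n) → ℝ} (hf : AEMeasurable f μ) (h : bmoNorm μ b f < ∞) :
    LocallyIntegrable f μ := by
  intro x
  let a : Fin n → ℝ := fun i => coords b x i - 1
  refine ⟨cube b a 2, ?_, ?_⟩
  · rw [cube_eq_preimage, box_eq_pi]
    refine (coords b).continuous.continuousAt (set_pi_mem_nhds finite_univ fun i _ => ?_)
    exact Icc_mem_nhds (by simp [a]) (by simp only [a]; linarith)
  have hfin : μ (cube b a 2) ≠ ∞ := (isCompact_cube b a 2).measure_lt_top.ne
  by_cases h0 : μ (cube b a 2) = 0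
  · rw [IntegrableOn, Measure.restrict_eq_zero.2 h0]
    exact integrable_zero_measure
  have : IsFiniteMeasure (μ.restrict (cube b a 2)) := ⟨by simpa using hfin.lt_top⟩
  have h1 : ⨍⁻ x in cube b a 2, ‖f x - ⨍ y in cube b a 2, f y ∂μ‖ₑ ∂μ < ∞ :=
    lt_of_le_of_lt (laverage_le_bmoNorm two_pos h0) h
  have h2 : ∫⁻ x in cube b a 2, ‖f x - ⨍ y in cube b a 2, f y ∂μ‖ₑ ∂μ < ∞ := by
    rw [← measure_mul_setLAverage _ hfin]
    exact ENNReal.mul_lt_top hfin.lt_top h1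
  have h3 : Integrable (fun x => f x - ⨍ y in cube b a 2, f y ∂μ) (μ.restrict (cube b a 2)) :=
    ⟨(hf.sub_const _).restrict.aestronglyMeasurable, h2⟩
  exact (h3.add (integrable_const (⨍ y in cube b a 2, f y ∂μ))).congr
    (Eventually.of_forall fun x => sub_add_cancel (f x) _)

end

end MinimalBMO

theorem theorem1p4 (n : ℕ) (φ : ℝ≥0 → ℝ≥0) (hmono : Monotone φ)
    (hconc : ConcaveOn ℝ≥0 Set.univ φ) (hcont : Continuous φ) (hzero : φ 0 = 0)
    (hlim : Tendsto φ atTop atTop) :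
    ∃ C : ℝ≥0, ∀ (μ : Measure (EuclideanSpace ℝ (Fin n))) [IsLocallyFiniteMeasure μ] [NullSingletonClass μ],
      (∃ b : OrthonormalBasis (Fin n) ℝ (EuclideanSpace ℝ (Fin n)),
        MinimalBMO.NullBoundaries μ b) ∧
      ∀ b : OrthonormalBasis (Fin n) ℝ (EuclideanSpace ℝ (Fin n)),
        MinimalBMO.NullBoundaries μ b →
          MinimalBMO.BMO μ b = MinimalBMO.BMOPhi φ μ b ∧
          ∀ f : EuclideanSpace ℝ (Fin n) → ℝ, AEMeasurable f μ →
            ((Function.invFun φ 1 : ℝ≥0) : ℝ≥0∞) * MinimalBMO.bmoPhiNorm φ μ b f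
                ≤ MinimalBMO.bmoNorm μ b f ∧
            MinimalBMO.bmoNorm μ b f ≤ (C : ℝ≥0∞) * MinimalBMO.bmoPhiNorm φ μ b f := by
  have hex : ∃ u, φ u = 1 := by
    obtain ⟨v, hv⟩ := (hlim.eventually_ge_atTop 1).exists
    exact mem_range_of_exists_le_of_exists_ge hcont ⟨0, by simp [hzero]⟩ ⟨v, hv⟩
  set u := Function.invFun φ 1 with hu_def
  have hφu : φ u = 1 := Function.invFun_eq hex
  have hu : 0 < u := by
    rw [pos_iff_ne_zero]
    intro h
    rw [h, hzero] at hφu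
    exact zero_ne_one hφu
  obtain ⟨t, ht, ht0⟩ :=
    ((hlim.eventually_ge_atTop (4 * 36 ^ n)).and (eventually_gt_atTop 0)).exists
  refine ⟨8 * t, fun μ _ _ => ⟨?_, fun b hb => ?_⟩⟩
  · obtain ⟨b, hb⟩ := MinimalBMO.exists_orthonormalBasis_measure_hyperplane_eq_zero
      (EuclideanSpace.basisFun (Fin n) ℝ) μ
    exact ⟨b, (MinimalBMO.nullBoundaries_iff μ b).2 hb⟩
  have hineq : ∀ f : EuclideanSpace ℝ (Fin n) → ℝ, AEMeasurable f μ →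
      (u : ℝ≥0∞) * MinimalBMO.bmoPhiNorm φ μ b f ≤ MinimalBMO.bmoNorm μ b f ∧
        MinimalBMO.bmoNorm μ b f ≤ ((8 * t : ℝ≥0) : ℝ≥0∞) * MinimalBMO.bmoPhiNorm φ μ b f :=
    fun f hf => ⟨MinimalBMO.mul_bmoPhiNorm_le hmono hconc hu hφu b f,
      MinimalBMO.bmoNorm_le_mul_bmoPhiNorm hmono hcont hb hf ht0 ht⟩
  refine ⟨Set.ext fun f => ⟨?_, ?_⟩, hineq⟩
  · rintro ⟨hf, hnorm⟩
    have hfm := hf.aestronglyMeasurable.aemeasurable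
    refine ⟨hfm, ?_⟩
    have h := (hineq f hfm).1.trans_lt hnorm
    exact ENNReal.lt_top_of_mul_ne_top_right h.ne (by simpa using hu.ne')
  · rintro ⟨hf, hnorm⟩
    have h := (hineq f hf).2.trans_lt (ENNReal.mul_lt_top ENNReal.coe_lt_top hnorm)
    exact ⟨MinimalBMO.locallyIntegrable_of_bmoNorm_lt_top hf h, h⟩
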